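/- For a finite simple graph $G=(V,E)$, a set $S\subseteq V$ is dominating if every vertex of $V\setminus S$ is adjacent to a vertex of $S$. The domination polynomial of $G$ is $D(G,x)=\sum_{i=0}^{|V|} d(G,i)\,x^i$, where $d(G,i)$ is the number of dominating sets of $G$ of cardinality $i$, and its complex roots are called the domination roots of $G$. For $n\ge 1$ let $F_n$ be the friendship graph, consisting of $n$ triangles that share one common vertex and are otherwise disjoint. For a family $(f_n)_{n\ge1}$ of complex polynomials, call $z\in\mathbb{C}$ a limit of roots of the family if either $f_n(z)=0$ for all sufficiently large $n$, or $z$ is a limit point (accumulation point) of the union over $n\ge 1$ of the sets of roots of the $f_n$. Theorem 3. The set of limits of roots of the family $(D(F_n,x))_{n\ge 1}$ is $$\{0\}\ \cup\ \left\{x\in\mathbb{C} : (\Re x+1)^2-(\Im x)^2=\tfrac12\right\},$$ where $0$ is an isolated point of this set and the hyperbola is the curve $|y^2-1|=|y|^2$ with $y=1+x$. Consequently, the domination roots of the friendship graphs have unbounded positive real part: for every real $M$ there are $n\ge 1$ and a root $x$ of $D(F_n,x)$ with $\Re x>M$. -/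

import Mathlib

open Polynomial Filter Topology

/-- `S` is a dominating set of `G`: every vertex outside `S` is adjacent to a vertex of `S`. -/
def IsDominatingSet {V : Type*} (G : SimpleGraph V) (S : Finset V) : Prop :=
  ∀ v, v ∉ S → ∃ u ∈ S, G.Adj v u

/-- The number `d(G, i)` of dominating sets of cardinality `i`. -/
noncomputable def numDominatingSets {V : Type*} (G : SimpleGraph V) (i : ℕ) : ℕ :=
  {S : Finset V | IsDominatingSet G S ∧ S.card = i}.ncard

/-- The domination polynomial `D(G, x) = ∑ d(G, i) x ^ i`, with complex coefficients.
The terms with `i` below the domination number vanish. -/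
noncomputable def dominationPolynomial {V : Type*} [Fintype V] (G : SimpleGraph V) : ℂ[X] :=
  ∑ i ∈ Finset.range (Fintype.card V + 1), C (numDominatingSets G i : ℂ) * X ^ i

/-- The friendship graph `F_n`: `n` triangles glued at a common vertex. The common vertex is
`none`, and the other two vertices of the `i`-th triangle are `some (i, false)` and
`some (i, true)`. -/
def friendshipGraph (n : ℕ) : SimpleGraph (Option (Fin n × Bool)) where
  Adj
    | none, none => False
    | none, some _ => True
    | some _, none => True
    | some a, some b => a.1 = b.1 ∧ a.2 ≠ b.2
  symm := ⟨by
    rintro (_ | a) (_ | b) h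
    · exact h
    · trivial
    · trivial
    · exact ⟨h.1.symm, h.2.symm⟩⟩
  loopless := ⟨by
    rintro (_ | a) h
    · exact h
    · exact h.2 rfl⟩

/-- `z` is a limit of roots of the family `f` (indexed by the positive integers): either
`f n` vanishes at `z` for all sufficiently large `n`, or `z` is a limit point of the union of
the root sets of the `f n`. -/
def IsLimitOfRoots (f : ℕ+ → ℂ[X]) (z : ℂ) : Prop :=
  (∀ᶠ n in atTop, (f n).IsRoot z) ∨ AccPt z (𝓟 (⋃ n, {w : ℂ | (f n).IsRoot w}))

/-- The set of limits of domination roots of the friendship graphs `F_n`, `n ≥ 1`. -/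
def friendshipLimitSet : Set ℂ :=
  {z | IsLimitOfRoots (fun n : ℕ+ => dominationPolynomial (friendshipGraph n)) z}

/-! A set containing the centre always dominates; one avoiding it dominates iff it meets every pair.
Hence `D(F_n, x) = (x² + 2x)^n + x (x + 1)^(2n)`, and with `y = x + 1` a root satisfies `(y² - 1)^n
= (1 - y) (y²)^n`. Off the curve `|y² - 1| = |y²|` one side is exponentially smaller than the other,
so for large `n` there are no roots near a point `x ≠ 0` (`AccPt.norm_eq_or_eq_zero`). Near a point
of the curve, taking logarithms turns the equation into `n s = h s + c` with `c` bounded, which a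
contraction solves for large `n` (`eventually_exists_sq_sub_one_pow_eq`). The curve is a hyperbola
with unbounded real part, and roots approach each of its points. -/

/-! ### Closed form of the domination polynomial -/

theorem dominationPolynomial_eq_sum {V : Type*} [Fintype V] [DecidableEq V] (G : SimpleGraph V)
    [DecidablePred (IsDominatingSet G)] :
    dominationPolynomial G =
      ∑ S : Finset V, if IsDominatingSet G S then (X : ℂ[X]) ^ S.card else 0 := by
  rw [← Finset.sum_filter, ← Finset.sum_fiberwise_of_maps_to (g := Finset.card)
    (t := Finset.range (Fintype.card V + 1))
    (fun S _ => Finset.mem_range.2 (Nat.lt_succ_of_le S.card_le_univ))]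
  refine Finset.sum_congr rfl fun i _ => ?_
  rw [Finset.sum_congr rfl (g := fun _ => (X : ℂ[X]) ^ i)
    (fun S hS => by rw [(Finset.mem_filter.1 hS).2]), Finset.sum_const, nsmul_eq_mul,
    Finset.filter_filter, numDominatingSets, Set.ncard_eq_toFinset_card', Set.toFinset_ofPred]
  simp

theorem friendshipGraph_isDominatingSet_insertNone {n : ℕ} (T : Finset (Fin n × Bool)) :
    IsDominatingSet (friendshipGraph n) T.insertNone := by
  rintro (_ | a) h
  · simp at h
  · exact ⟨none, by simp, trivial⟩

theorem friendshipGraph_isDominatingSet_map_some {n : ℕ} (hn : 0 < n) (T : Finset (Fin n × Bool)) :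
    IsDominatingSet (friendshipGraph n) (T.map Function.Embedding.some) ↔
      ∀ i, ∃ b, (i, b) ∈ T := by
  constructor
  · intro h i
    by_contra! hi
    obtain ⟨u, hu, hadj⟩ := h (some (i, false)) (by simpa using hi false)
    obtain ⟨⟨j, b⟩, hj, rfl⟩ := Finset.mem_map.1 hu
    obtain rfl : i = j := hadj.1
    exact hi b hj
  · rintro h (_ | ⟨i, b⟩) hv
    · obtain ⟨b, hb⟩ := h ⟨0, hn⟩
      exact ⟨some (⟨0, hn⟩, b), by simpa using hb, trivial⟩
    · obtain ⟨c, hc⟩ := h i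
      refine ⟨some (i, c), by simpa using hc, rfl, ?_⟩
      rintro (rfl : b = c)
      exact hv (by simpa using hc)

/-- A finite set of outer vertices corresponds to the family of its traces on the `n` pairs. -/
def finsetProdBoolEquiv (n : ℕ) : (Fin n → Finset Bool) ≃ Finset (Fin n × Bool) where
  toFun p := Finset.univ.filter fun a => a.2 ∈ p a.1
  invFun T i := Finset.univ.filter fun b => (i, b) ∈ T
  left_inv p := by ext; simp
  right_inv T := by ext; simp

theorem card_finsetProdBoolEquiv {n : ℕ} (p : Fin n → Finset Bool) :
    (finsetProdBoolEquiv n p).card = ∑ i, (p i).card := by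
  rw [finsetProdBoolEquiv, Equiv.coe_fn_mk, Finset.card_filter, Fintype.sum_prod_type]
  refine Finset.sum_congr rfl fun i _ => ?_
  rw [← Finset.card_filter]
  exact congrArg Finset.card (Finset.filter_univ_mem (p i))

/-- The pairs are independent, and the nonempty subsets of one pair contribute `x + x + x²`. -/
theorem sum_pow_card_of_forall_exists_mem {R : Type*} [CommSemiring R] (n : ℕ) (x : R) :
    (∑ T : Finset (Fin n × Bool), if ∀ i, ∃ b, (i, b) ∈ T then x ^ T.card else 0) =
      (x ^ 2 + 2 * x) ^ n := by
  have h : x ^ 2 + 2 * x = ∑ B ∈ (Finset.univ : Finset (Finset Bool)).filter Finset.Nonempty,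
      x ^ B.card := by
    rw [show (Finset.univ : Finset (Finset Bool)).filter Finset.Nonempty =
      {{false}, {true}, {false, true}} by decide]
    rw [Finset.sum_insert (by decide), Finset.sum_insert (by decide), Finset.sum_singleton]
    simp
    ring
  have h' : (x ^ 2 + 2 * x) ^ n = ∏ _i : Fin n, (x ^ 2 + 2 * x) := by simp
  rw [h', h, Finset.prod_univ_sum, ← Equiv.sum_comp (finsetProdBoolEquiv n), ← Finset.sum_filter]
  refine Finset.sum_congr ?_ fun p _ => by rw [card_finsetProdBoolEquiv, Finset.prod_pow_eq_pow_sum]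
  ext p
  simp [finsetProdBoolEquiv, Finset.Nonempty]

theorem sum_finset_option {α M : Type*} [Fintype α] [DecidableEq α] [AddCommMonoid M]
    (f : Finset (Option α) → M) :
    ∑ S, f S = ∑ T : Finset α, f (T.map Function.Embedding.some) +
      ∑ T : Finset α, f T.insertNone := by
  rw [← Finset.sum_filter_add_sum_filter_not Finset.univ (fun S => none ∉ S)]
  congr 1
  · refine (Finset.sum_bij' (fun T _ => T.map Function.Embedding.some)
      (fun S _ => S.eraseNone) ?_ ?_ ?_ ?_ ?_).symm
    · simp
    · simp
    · intro T _; ext; simp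
    · intro S hS
      rw [Finset.map_some_eraseNone, Finset.erase_eq_of_notMem (Finset.mem_filter.1 hS).2]
    · simp
  · refine (Finset.sum_bij' (fun T _ => T.insertNone)
      (fun S _ => S.eraseNone) ?_ ?_ ?_ ?_ ?_).symm
    · simp
    · simp
    · intro T _; ext; simp
    · intro S hS
      rw [Finset.insertNone_eraseNone, Finset.insert_eq_of_mem]
      simpa using hS
    · simp

theorem dominationPolynomial_friendshipGraph {n : ℕ} (hn : 0 < n) :
    dominationPolynomial (friendshipGraph n) = (X ^ 2 + 2 * X) ^ n + X * (X + 1) ^ (2 * n) := by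
  classical
  rw [dominationPolynomial_eq_sum, sum_finset_option]
  congr 1
  · rw [← sum_pow_card_of_forall_exists_mem]
    exact Finset.sum_congr rfl fun T _ => by
      simp only [friendshipGraph_isDominatingSet_map_some hn, Finset.card_map]
  · simp only [friendshipGraph_isDominatingSet_insertNone, if_true, Finset.card_insertNone,
      pow_succ', ← Finset.mul_sum]
    congr 1
    have h := Fintype.sum_pow_mul_eq_add_pow (Fin n × Bool) (X : ℂ[X]) 1
    simp only [one_pow, mul_one, Fintype.card_prod, Fintype.card_fin, Fintype.card_bool] at h
    rw [h, mul_comm]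

theorem isRoot_dominationPolynomial_friendshipGraph {n : ℕ+} {z : ℂ} :
    (dominationPolynomial (friendshipGraph n)).IsRoot z ↔
      ((z + 1) ^ 2 - 1) ^ (n : ℕ) = -z * ((z + 1) ^ 2) ^ (n : ℕ) := by
  rw [dominationPolynomial_friendshipGraph n.pos, IsRoot.def]
  simp only [eval_add, eval_mul, eval_pow, eval_X, eval_one, eval_ofNat]
  rw [pow_mul, show z ^ 2 + 2 * z = (z + 1) ^ 2 - 1 by ring, neg_mul, eq_neg_iff_add_eq_zero]

/-! ### Roots near the curve -/

theorem Complex.norm_sub_one_eq_norm_iff (w : ℂ) : ‖w - 1‖ = ‖w‖ ↔ w.re = 1 / 2 := by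
  rw [← sq_eq_sq₀ (norm_nonneg _) (norm_nonneg _), Complex.sq_norm, Complex.sq_norm,
    Complex.normSq_apply, Complex.normSq_apply]
  simp only [Complex.sub_re, Complex.sub_im, Complex.one_re, Complex.one_im]
  constructor <;> intro h <;> linarith

theorem norm_sq_sub_one_eq_norm_sq_iff (z : ℂ) :
    ‖(z + 1) ^ 2 - 1‖ = ‖(z + 1) ^ 2‖ ↔ (z.re + 1) ^ 2 - z.im ^ 2 = 1 / 2 := by
  rw [Complex.norm_sub_one_eq_norm_iff]
  simp [sq]

/-- `s ↦ (h s + c) / n` contracts a small ball into itself. Uniformity in `c` is needed because `c`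
will depend on `n`. -/
theorem eventually_exists_natCast_mul_eq {h : ℂ → ℂ} (hh : ContDiffAt ℂ 1 h 0) (B : ℝ) {ε : ℝ}
    (hε : 0 < ε) :
    ∀ᶠ n : ℕ in atTop, ∀ c : ℂ, ‖c‖ ≤ B → ∃ s : ℂ, ‖s‖ ≤ ε ∧ n * s = h s + c := by
  obtain ⟨K, t, ht, hK⟩ := hh.exists_lipschitzOnWith
  obtain ⟨δ₀, hδ₀, hball⟩ := Metric.nhds_basis_closedBall.mem_iff.1 ht
  set δ := min δ₀ ε
  have hδ : 0 < δ := lt_min hδ₀ hε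
  have hK' : LipschitzOnWith K h (Metric.closedBall 0 δ) :=
    hK.mono ((Metric.closedBall_subset_closedBall (min_le_left _ _)).trans hball)
  -- The second bound on `n` makes the ball invariant; the third makes the Lipschitz constant at
  -- most `1 / 2`.
  filter_upwards [eventually_gt_atTop 0, eventually_ge_atTop ⌈(‖h 0‖ + K * δ + B) / δ⌉₊,
    eventually_ge_atTop ⌈2 * (K : ℝ)⌉₊] with n hn0 hn1 hn2 c hc
  have hn : (0 : ℝ) < n := Nat.cast_pos.2 hn0
  have hnC : (n : ℂ) ≠ 0 := Nat.cast_ne_zero.2 hn0.ne'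
  have h1 : ‖h 0‖ + K * δ + B ≤ n * δ := (div_le_iff₀ hδ).1 (Nat.ceil_le.1 hn1)
  have h2 : 2 * (K : ℝ) ≤ n := Nat.ceil_le.1 hn2
  let f : ℂ → ℂ := fun s => (h s + c) / n
  have hmaps : Set.MapsTo f (Metric.closedBall 0 δ) (Metric.closedBall 0 δ) := by
    intro s hs
    have h3 := hK'.dist_le_mul s hs 0 (Metric.mem_closedBall_self hδ.le)
    rw [mem_closedBall_zero_iff] at hs ⊢
    rw [dist_eq_norm, dist_zero_right] at h3
    have h4 : ‖h s + c‖ ≤ n * δ := by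
      calc ‖h s + c‖ ≤ ‖h s‖ + ‖c‖ := norm_add_le _ _
        _ ≤ (‖h 0‖ + ‖h s - h 0‖) + ‖c‖ := by gcongr; exact norm_le_norm_add_norm_sub' _ _
        _ ≤ (‖h 0‖ + K * δ) + B := by
          have := mul_le_mul_of_nonneg_left hs K.2
          gcongr
          exact h3.trans this
        _ ≤ n * δ := h1
    rw [norm_div, Complex.norm_natCast, div_le_iff₀ hn]
    linarith
  have hcontr : ContractingWith (1 / 2) (hmaps.restrict f _ _) := by
    refine ⟨by norm_num, LipschitzWith.of_dist_le_mul fun a b => ?_⟩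
    have h3 := hK'.dist_le_mul a a.2 b b.2
    rw [Subtype.dist_eq, Subtype.dist_eq, Set.MapsTo.val_restrict_apply,
      Set.MapsTo.val_restrict_apply, dist_eq_norm, dist_eq_norm]
    rw [dist_eq_norm, dist_eq_norm] at h3
    have h4 : f a - f b = (h a - h b) / n := by simp only [f]; ring
    rw [h4, norm_div, Complex.norm_natCast, div_le_iff₀ hn]
    refine h3.trans ?_
    have := mul_le_mul_of_nonneg_right h2 (norm_nonneg ((a : ℂ) - b))
    push_cast
    linarith
  obtain ⟨s, hs, hfix, -⟩ := hcontr.exists_fixedPoint' Metric.isClosed_closedBall.isComplete hmaps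
    (Metric.mem_closedBall_self hδ.le) (edist_ne_top _ _)
  refine ⟨s, (mem_closedBall_zero_iff.1 hs).trans (min_le_right _ _), ?_⟩
  have hfix' : (h s + c) / n = s := hfix
  nth_rw 1 [← hfix']
  field_simp

theorem Complex.norm_log_le_pi {w : ℂ} (hw : ‖w‖ = 1) : ‖Complex.log w‖ ≤ Real.pi := by
  have h : Complex.log w = Complex.arg w * Complex.I := by simp [Complex.log, hw]
  rw [h]
  simpa using Complex.abs_arg_le_pi w

theorem eventually_exists_sq_sub_one_pow_eq {y₀ : ℂ} (hy : ‖y₀ ^ 2 - 1‖ = ‖y₀ ^ 2‖) {U : Set ℂ}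
    (hU : U ∈ 𝓝 y₀) :
    ∀ᶠ n : ℕ in atTop, ∃ y ∈ U, (y ^ 2 - 1) ^ n = (1 - y) * (y ^ 2) ^ n := by
  have hy0 : y₀ ≠ 0 := by rintro rfl; norm_num at hy
  have hy1 : 1 - y₀ ≠ 0 := by
    intro h
    obtain rfl : 1 = y₀ := sub_eq_zero.1 h
    norm_num at hy
  obtain ⟨r, hr⟩ : ∃ r, r = (y₀ ^ 2 - 1) / y₀ ^ 2 := ⟨_, rfl⟩
  have hrn : ‖r‖ = 1 := by
    rw [hr, norm_div, hy, div_self (norm_ne_zero_iff.2 (pow_ne_zero 2 hy0))]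
  have hr1 : y₀ ^ 2 * (1 - r) = 1 := by rw [hr]; field_simp; ring
  have hr2 : 1 - r ≠ 0 := right_ne_zero_of_mul_eq_one hr1
  have hr0 : r ≠ 0 := norm_ne_zero_iff.1 (by rw [hrn]; exact one_ne_zero)
  -- `Y` is the local branch of `Y² - 1 = r e^s Y²` through `y₀`, and `h` a local logarithm of `1 -
  -- Y`. Dividing by the value at `0` keeps each varying logarithm near `log 1`, away from the cut.
  let q : ℂ → ℂ := fun s => (1 - r) / (1 - r * Complex.exp s)
  let Y : ℂ → ℂ := fun s => y₀ * Complex.exp (Complex.log (q s) / 2)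
  let h : ℂ → ℂ := fun s => Complex.log (1 - y₀) + Complex.log ((1 - Y s) / (1 - y₀))
  have hq0 : q 0 = 1 := by simp [q, hr2]
  have hY0 : Y 0 = y₀ := by simp [Y, hq0]
  have hq : ContDiffAt ℂ 1 q 0 := by
    refine contDiffAt_const.div (contDiffAt_const.sub (contDiffAt_const.mul ?_)) (by simpa using hr2)
    exact Complex.contDiff_exp.contDiffAt
  have hY : ContDiffAt ℂ 1 Y 0 := by
    refine contDiffAt_const.mul
      ((((Complex.contDiffAt_log ?_).comp 0 hq).div_const 2).cexp)
    rw [hq0]; exact Complex.one_mem_slitPlane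
  have hh : ContDiffAt ℂ 1 h 0 := by
    refine contDiffAt_const.add
      ((Complex.contDiffAt_log ?_).comp 0 ((contDiffAt_const.sub hY).div_const _))
    rw [hY0, div_self hy1]; exact Complex.one_mem_slitPlane
  have hd : ContinuousAt (fun s : ℂ => 1 - r * Complex.exp s) 0 := by fun_prop
  have hev : ∀ᶠ s in 𝓝 (0 : ℂ), Y s ∈ U ∧ 1 - Y s ≠ 0 ∧ 1 - r * Complex.exp s ≠ 0 := by
    refine (hY.continuousAt.eventually_mem (by rwa [hY0])).and
      (((continuousAt_const.sub hY.continuousAt).eventually_ne ?_).and (hd.eventually_ne ?_))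
    · rwa [Pi.sub_apply, hY0]
    · simpa using hr2
  obtain ⟨ε, hε, hball⟩ := Metric.nhds_basis_closedBall.mem_iff.1 hev
  filter_upwards [eventually_exists_natCast_mul_eq hh Real.pi hε] with n hn
  have hrn' : ‖r ^ n‖ = 1 := by rw [norm_pow, hrn, one_pow]
  -- The principal logarithm of `r ^ n` is bounded by `π` for every `n`, unlike `n * log r`.
  obtain ⟨s, hs, heq⟩ := hn (-Complex.log (r ^ n)) (by
    rw [norm_neg]; exact Complex.norm_log_le_pi hrn')
  obtain ⟨hsU, hs1, hs2⟩ := hball (mem_closedBall_zero_iff.2 hs)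
  refine ⟨Y s, hsU, ?_⟩
  have hqs : q s ≠ 0 := div_ne_zero hr2 hs2
  have hY2 : Y s ^ 2 * (1 - r * Complex.exp s) = 1 := by
    have : Complex.exp (Complex.log (q s) / 2) ^ 2 = q s := by
      rw [← Complex.exp_nat_mul]
      push_cast
      rw [mul_div_cancel₀ _ two_ne_zero, Complex.exp_log hqs]
    simp only [Y, mul_pow, this]
    simp only [q]
    rw [mul_assoc, div_mul_cancel₀ _ hs2, hr1]
  have hexp : r ^ n * Complex.exp s ^ n = 1 - Y s := by
    rw [← Complex.exp_nat_mul, heq]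
    simp only [h]
    rw [Complex.exp_add, Complex.exp_add, Complex.exp_neg, Complex.exp_log hy1,
      Complex.exp_log (div_ne_zero hs1 hy1), Complex.exp_log (pow_ne_zero n hr0)]
    field_simp
  rw [show Y s ^ 2 - 1 = r * Complex.exp s * Y s ^ 2 by linear_combination hY2, mul_pow, mul_pow,
    hexp]

/-! ### Limits of roots -/

theorem isLimitOfRoots_of_eventually {f : ℕ+ → ℂ[X]} {z : ℂ}
    (h : ∀ U ∈ 𝓝 z, ∀ᶠ n in atTop, ∃ w ∈ U, (f n).IsRoot w) : IsLimitOfRoots f z := by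
  by_cases hz : ∀ᶠ n in atTop, (f n).IsRoot z
  · exact Or.inl hz
  · refine Or.inr (accPt_iff_nhds.2 fun U hU => ?_)
    obtain ⟨n, hn, w, hw, hroot⟩ := ((not_eventually.1 hz).and_eventually (h U hU)).exists
    refine ⟨w, ⟨hw, Set.mem_iUnion.2 ⟨n, hroot⟩⟩, ?_⟩
    rintro rfl
    exact hn hroot

/-- The polynomials of index below `N` have finitely many roots in all, so these cannot account for
the accumulation. -/
theorem AccPt.frequently_exists_isRoot {f : ℕ+ → ℂ[X]} (hf : ∀ n, f n ≠ 0) {z : ℂ}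
    (hz : AccPt z (𝓟 (⋃ n, {w : ℂ | (f n).IsRoot w}))) {U : Set ℂ} (hU : U ∈ 𝓝 z) :
    ∃ᶠ n in atTop, ∃ w ∈ U, w ≠ z ∧ (f n).IsRoot w := by
  refine frequently_atTop.2 fun N => ?_
  set S : Set ℂ := (⋃ n ∈ Set.Iio N, {w : ℂ | (f n).IsRoot w}) \ {z}
  have hS : S.Finite := by
    refine Set.Finite.sdiff (Set.Finite.biUnion (Set.finite_Iio N) fun n _ => ?_)
    exact Polynomial.finite_setOfPred_isRoot (hf n)
  have hSz : Sᶜ ∈ 𝓝 z := hS.isClosed.isOpen_compl.mem_nhds fun h => h.2 rfl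
  obtain ⟨w, ⟨⟨hwU, hwS⟩, hw⟩, hne⟩ := accPt_iff_nhds.1 hz _ (inter_mem hU hSz)
  obtain ⟨n, hn⟩ := Set.mem_iUnion.1 hw
  refine ⟨n, not_lt.1 fun hlt => hwS ⟨Set.mem_biUnion hlt hn, hne⟩, w, hwU, hne, hn⟩

theorem dominationPolynomial_friendshipGraph_ne_zero (n : ℕ+) :
    dominationPolynomial (friendshipGraph n) ≠ 0 := by
  intro h
  have h1 : (dominationPolynomial (friendshipGraph n)).IsRoot (-1) := by rw [h]; simp
  rw [isRoot_dominationPolynomial_friendshipGraph] at h1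
  simp at h1

theorem eq_zero_of_eventually_isRoot {z : ℂ}
    (h : ∀ᶠ n : ℕ+ in atTop, (dominationPolynomial (friendshipGraph n)).IsRoot z) : z = 0 := by
  obtain ⟨N, hN⟩ := eventually_atTop.1 h
  have h1 := isRoot_dominationPolynomial_friendshipGraph.1 (hN N le_rfl)
  have h2 := isRoot_dominationPolynomial_friendshipGraph.1 (hN (N + 1) (PNat.lt_add_right N 1).le)
  rw [PNat.add_coe, PNat.one_coe, pow_succ, h1, pow_succ] at h2
  by_contra hz
  -- The equations for `N` and `N + 1` give both `y² - 1` and `y²` as the ratio, unless both sides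
  -- vanish.
  have h3 : -z * ((z + 1) ^ 2) ^ (N : ℕ) = 0 := by linear_combination -h2
  have h4 : (z + 1) ^ 2 = 0 :=
    eq_zero_of_pow_eq_zero ((mul_eq_zero.1 h3).resolve_left (neg_ne_zero.2 hz))
  rw [h3, h4] at h1
  simp at h1

theorem exists_lt_one_lt_mul {p q : ℝ} (hp : 0 ≤ p) (hpq : p < q) :
    ∃ c, 0 ≤ c ∧ c < 1 ∧ p < c * q := by
  have hq : 0 < q := hp.trans_lt hpq
  obtain ⟨c, hc, hc1⟩ := exists_between ((div_lt_one hq).2 hpq)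
  exact ⟨c, (div_nonneg hp hq.le).trans hc.le, hc1, (div_lt_iff₀ hq).1 hc⟩

theorem PNat.eventually_mul_pow_lt (C : ℝ) {c ε : ℝ} (hc : 0 ≤ c) (hc1 : c < 1) (hε : 0 < ε) :
    ∀ᶠ n : ℕ+ in atTop, C * c ^ (n : ℕ) < ε := by
  have h := ((tendsto_pow_atTop_nhds_zero_of_lt_one hc hc1).const_mul C).comp
    tendsto_PNat_val_atTop_atTop
  rw [mul_zero] at h
  exact h.eventually_lt_const hε

theorem AccPt.norm_eq_or_eq_zero {z : ℂ}
    (h : AccPt z (𝓟 (⋃ n : ℕ+, {w : ℂ | (dominationPolynomial (friendshipGraph n)).IsRoot w}))) :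
    z = 0 ∨ ‖(z + 1) ^ 2 - 1‖ = ‖(z + 1) ^ 2‖ := by
  by_contra! hz
  obtain ⟨hz0, hne⟩ := hz
  have hfreq {U : Set ℂ} (hU : U ∈ 𝓝 z) := AccPt.frequently_exists_isRoot
    dominationPolynomial_friendshipGraph_ne_zero h hU
  rcases hne.lt_or_gt with hlt | hlt
  -- A root `w` near `z` would satisfy `‖w‖ ≤ c ^ n`, yet `‖w‖` stays above `‖z‖ / 2`.
  · obtain ⟨c, hc, hc1, hcz⟩ := exists_lt_one_lt_mul (norm_nonneg _) hlt
    have hzpos : 0 < ‖z‖ / 2 := half_pos (norm_pos_iff.2 hz0)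
    have hU : {w : ℂ | ‖(w + 1) ^ 2 - 1‖ < c * ‖(w + 1) ^ 2‖ ∧ ‖z‖ / 2 < ‖w‖} ∈ 𝓝 z :=
      (ContinuousAt.eventually_lt (by fun_prop) (by fun_prop) hcz).and
        (continuous_norm.continuousAt.eventually_const_lt (half_lt_self (norm_pos_iff.2 hz0)))
    obtain ⟨n, ⟨w, ⟨hw, hwz⟩, -, hroot⟩, hn⟩ :=
      ((hfreq hU).and_eventually (PNat.eventually_mul_pow_lt 1 hc hc1 hzpos)).exists
    have heq := congrArg norm (isRoot_dominationPolynomial_friendshipGraph.1 hroot)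
    rw [norm_pow, norm_mul, norm_neg, norm_pow _ (n : ℕ)] at heq
    have hpos : 0 < ‖(w + 1) ^ 2‖ :=
      pos_of_mul_pos_right ((norm_nonneg _).trans_lt hw) hc
    have hle : ‖w‖ * ‖(w + 1) ^ 2‖ ^ (n : ℕ) ≤ c ^ (n : ℕ) * ‖(w + 1) ^ 2‖ ^ (n : ℕ) := by
      rw [← heq, ← mul_pow]
      exact pow_le_pow_left₀ (norm_nonneg _) hw.le _
    have := le_of_mul_le_mul_right hle (pow_pos hpos _)
    linarith
  -- Here a root would give `1 ≤ ‖w‖ c ^ n` with `‖w‖` bounded.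
  · obtain ⟨c, hc, hc1, hcz⟩ := exists_lt_one_lt_mul (norm_nonneg _) hlt
    have hU : {w : ℂ | ‖(w + 1) ^ 2‖ < c * ‖(w + 1) ^ 2 - 1‖ ∧ ‖w‖ < ‖z‖ + 1} ∈ 𝓝 z :=
      (ContinuousAt.eventually_lt (by fun_prop) (by fun_prop) hcz).and
        (continuous_norm.continuousAt.eventually_lt_const (lt_add_one _))
    obtain ⟨n, ⟨w, ⟨hw, hwz⟩, -, hroot⟩, hn⟩ :=
      ((hfreq hU).and_eventually (PNat.eventually_mul_pow_lt (‖z‖ + 1) hc hc1 one_pos)).exists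
    have heq := congrArg norm (isRoot_dominationPolynomial_friendshipGraph.1 hroot)
    rw [norm_pow, norm_mul, norm_neg, norm_pow _ (n : ℕ)] at heq
    have hpos : 0 < ‖(w + 1) ^ 2 - 1‖ :=
      pos_of_mul_pos_right ((norm_nonneg _).trans_lt hw) hc
    have hle : 1 * ‖(w + 1) ^ 2 - 1‖ ^ (n : ℕ) ≤
        (‖z‖ + 1) * c ^ (n : ℕ) * ‖(w + 1) ^ 2 - 1‖ ^ (n : ℕ) := by
      rw [mul_assoc, ← mul_pow, one_mul, heq]
      exact mul_le_mul hwz.le (pow_le_pow_left₀ (norm_nonneg _) hw.le _) (by positivity)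
        (by positivity)
    have := le_of_mul_le_mul_right hle (pow_pos hpos _)
    linarith

theorem eventually_exists_isRoot_of_norm_eq {z : ℂ} (hz : ‖(z + 1) ^ 2 - 1‖ = ‖(z + 1) ^ 2‖)
    {U : Set ℂ} (hU : U ∈ 𝓝 z) :
    ∀ᶠ n : ℕ+ in atTop, ∃ w ∈ U, (dominationPolynomial (friendshipGraph n)).IsRoot w := by
  have hU' : (fun y : ℂ => y - 1) ⁻¹' U ∈ 𝓝 (z + 1) :=
    (continuous_id.sub continuous_const).continuousAt.preimage_mem_nhds (by simpa using hU)
  filter_upwards [tendsto_PNat_val_atTop_atTop.eventually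
    (eventually_exists_sq_sub_one_pow_eq hz hU')] with n ⟨y, hy, heq⟩
  refine ⟨y - 1, hy, isRoot_dominationPolynomial_friendshipGraph.2 ?_⟩
  rw [sub_add_cancel, neg_sub]
  exact heq

theorem friendshipLimitSet_eq :
    friendshipLimitSet = {0} ∪ {z : ℂ | (z.re + 1) ^ 2 - z.im ^ 2 = 1 / 2} := by
  ext z
  rw [Set.mem_union, Set.mem_singleton_iff, Set.mem_ofPred_eq, ← norm_sq_sub_one_eq_norm_sq_iff]
  constructor
  · rintro (h | h)
    · exact Or.inl (eq_zero_of_eventually_isRoot h)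
    · exact AccPt.norm_eq_or_eq_zero h
  · rintro (rfl | h)
    · refine Or.inl (Eventually.of_forall fun n => ?_)
      rw [isRoot_dominationPolynomial_friendshipGraph]
      simp
    · exact isLimitOfRoots_of_eventually fun U hU => eventually_exists_isRoot_of_norm_eq h hU

theorem theorem3 :
    friendshipLimitSet = {0} ∪ {z : ℂ | (z.re + 1) ^ 2 - z.im ^ 2 = 1 / 2} ∧
    {z : ℂ | ‖(z + 1) ^ 2 - 1‖ = ‖z + 1‖ ^ 2} =
      {z : ℂ | (z.re + 1) ^ 2 - z.im ^ 2 = 1 / 2} ∧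
    ¬ AccPt (0 : ℂ) (𝓟 friendshipLimitSet) ∧
    ∀ M : ℝ, ∃ n : ℕ+, ∃ z : ℂ,
      (dominationPolynomial (friendshipGraph n)).IsRoot z ∧ M < z.re := by
  refine ⟨friendshipLimitSet_eq, ?_, ?_, fun M => ?_⟩
  · ext z
    rw [Set.mem_ofPred_eq, Set.mem_ofPred_eq, ← norm_pow, norm_sq_sub_one_eq_norm_sq_iff]
  · intro h
    have hU : {z : ℂ | (z.re + 1) ^ 2 - z.im ^ 2 ≠ 1 / 2} ∈ 𝓝 0 :=
      (isOpen_ne_fun (by fun_prop) continuous_const).mem_nhds (by norm_num)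
    obtain ⟨z, ⟨hz, hmem⟩, hne⟩ := accPt_iff_nhds.1 h _ hU
    rw [friendshipLimitSet_eq] at hmem
    exact hmem.elim hne hz
  · let t : ℝ := |M| + 1
    have ht : 0 < t := by positivity
    -- The point of the right branch at height `t`; its real part exceeds `t - 1 = |M|`.
    let z : ℂ := ⟨√(1 / 2 + t ^ 2) - 1, t⟩
    have hz : (z.re + 1) ^ 2 - z.im ^ 2 = 1 / 2 := by
      simp only [z, sub_add_cancel]
      rw [Real.sq_sqrt (by positivity)]
      ring
    have hM : M < z.re := by
      have h1 : t < √(1 / 2 + t ^ 2) := Real.lt_sqrt_of_sq_lt (by linarith)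
      have h2 := le_abs_self M
      simp only [z, t] at h1 ⊢
      linarith
    obtain ⟨n, w, hw, hroot⟩ := (eventually_exists_isRoot_of_norm_eq
      ((norm_sq_sub_one_eq_norm_sq_iff z).2 hz)
      ((isOpen_lt continuous_const Complex.continuous_re).mem_nhds hM)).exists
    exact ⟨n, w, hroot, hw⟩
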